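/- Let $(\Omega,\Sigma,\mathbb P)$ be a probability space, let $L^0$ be the ordered ring of real-valued $\Sigma$-measurable random variables and $\bar L^0$ the set of $\Sigma$-measurable functions $\Omega\to[-\infty,+\infty]$, both modulo almost sure equality and ordered almost surely; for $\eta\in L^0$, $\eta>0$ means $\mathbb P(\eta>0)=1$. Equip $L^0$ with the topology in which the sets $\{y\in L^0: |y-x|\le\varepsilon\}$ ($\varepsilon\in L^0$, $\varepsilon>0$) form a neighbourhood base at $x$. Let $E$ be an $L^0$-module. It has the countable concatenation property if for every sequence $(x_k)$ in $E$ and every countable measurable partition $(A_k)$ of $\Omega$ there is a unique $x\in E$, written $\sum 1_{A_k}x_k$, with $1_{A_k}x=1_{A_k}x_k$ for all $k$. In that case a non-empty $S\subset E$ is stable if $\sum 1_{A_k}x_k\in S$ whenever all $x_k\in S$. A non-empty collection $\mathscr C$ of subsets of $E$ is stable if each $S\in\mathscr C$ is stable and $\sum 1_{A_k}S_k:=\{\sum 1_{A_k}x_k: x_k\in S_k\}\in\mathscr C$ for all $S_k\in\mathscr C$ and all countable measurable partitions $(A_k)$. A subset $S\subset E$ is $L^0$-convex if $\eta x+(1-\eta)y\in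 S$ for all $x,y\in S$ and $\eta\in L^0$ with $0\le\eta\le1$; $L^0$-absorbing if for each $x\in E$ there is $\eta\in L^0$, $\eta>0$, with $x\in\eta S$; $L^0$-balanced if $\eta x\in S$ for all $x\in S$ and $\eta\in L^0$ with $|\eta|\le1$. A stable locally $L^0$-convex module is an $L^0$-module $E$ with the countable concatenation property and a topology for which addition $E\times E\to E$ and scalar multiplication $L^0\times E\to E$ are continuous and for which $0$ has a neighbourhood base that is a stable collection of $L^0$-convex, $L^0$-absorbing, $L^0$-balanced sets. A function $f:E\to\bar L^0$ is proper if $f(x)>-\infty$ almost surely for every $x\in E$ and $f(x_0)\in L^0$ for some $x_0\in E$; lower semicontinuous if $\{x\in E: f(x)\le\eta\}$ is closed for every $\eta\in\bar L^0$; $L^0$-convex if $f(\eta x+(1-\eta)y)\le\eta f(x)+(1-\eta)f(y)$ for all $x,y\in E$ and $\eta\in L^0$ with $0\le\eta\le1$ (with $0\cdot(\pm\infty)=0$). Let $E^*$ be the set of continuous $L^0$-linear maps $E\to L^0$, and put $$f^*(\mu)=\operatorname*{ess\,sup}_{x\in E}\,(\mu(x)-f(x))\quad(\mu\in E^*),\qquad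 f^{**}(x)=\operatorname*{ess\,sup}_{\mu\in E^*}\,(\mu(x)-f^*(\mu))\quad(x\in E),$$ where the essential supremum of a family in $\bar L^0$ is its least upper bound in $\bar L^0$. Theorem. If $E$ is a stable locally $L^0$-convex module and $f:E\to\bar L^0$ is proper, lower semicontinuous and $L^0$-convex, then $f^{**}=f$. -/

import Mathlib

open MeasureTheory Topology

namespace L0Mod

noncomputable section

/-- `L⁰`: real-valued random variables, identified when they agree almost surely.
It carries the almost sure order and the pointwise operations. -/
abbrev L0 {Ω : Type*} [MeasurableSpace Ω] (P : Measure Ω) : Type _ := Ω →ₘ[P] ℝ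

/-- The extended `L⁰`: classes of measurable functions with values in `[-∞, +∞]`,
with the almost sure order. -/
abbrev L0bar {Ω : Type*} [MeasurableSpace Ω] (P : Measure Ω) : Type _ := Ω →ₘ[P] EReal

section Ring

variable {Ω : Type*} [MeasurableSpace Ω] {P : Measure Ω}

/-- The ring structure of `L⁰`, on top of Mathlib's pointwise operations. -/
instance instCommRingL0 : CommRing (L0 P) :=
  { (AEEqFun.instAddCommGroup : AddCommGroup (Ω →ₘ[P] ℝ)),
    (AEEqFun.instCommMonoid : CommMonoid (Ω →ₘ[P] ℝ)) with
    left_distrib := by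
      intro a b c
      apply AEEqFun.ext
      filter_upwards [AEEqFun.coeFn_mul a (b + c), AEEqFun.coeFn_add b c,
        AEEqFun.coeFn_add (a * b) (a * c), AEEqFun.coeFn_mul a b, AEEqFun.coeFn_mul a c]
        with ω h1 h2 h3 h4 h5
      exact h1.trans (by simp only [Pi.mul_apply, Pi.add_apply, h2, h3.trans, h4, h5, mul_add])
    right_distrib := by
      intro a b c
      apply AEEqFun.ext
      filter_upwards [AEEqFun.coeFn_mul (a + b) c, AEEqFun.coeFn_add a b,
        AEEqFun.coeFn_add (a * c) (b * c), AEEqFun.coeFn_mul a c, AEEqFun.coeFn_mul b c]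
        with ω h1 h2 h3 h4 h5
      exact h1.trans (by simp only [Pi.mul_apply, Pi.add_apply, h2, h3.trans, h4, h5, add_mul])
    zero_mul := by
      intro a
      apply AEEqFun.ext
      filter_upwards [AEEqFun.coeFn_mul 0 a, AEEqFun.coeFn_zero (α := Ω) (μ := P) (β := ℝ)]
        with ω h1 h2
      exact h1.trans (by simp [h2])
    mul_zero := by
      intro a
      apply AEEqFun.ext
      filter_upwards [AEEqFun.coeFn_mul a 0, AEEqFun.coeFn_zero (α := Ω) (μ := P) (β := ℝ)]
        with ω h1 h2
      exact h1.trans (by simp [h2]) }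

/-- `η > 0` in the sense of `L⁰`-analysis: strictly positive almost surely. -/
def AEPos (η : L0 P) : Prop := ∀ᵐ ω ∂P, 0 < η ω

/-- The topology of almost sure dominance on `L⁰`: the balls `{y : |y - x| ≤ ε}`, for `ε ∈ L⁰`
with `ε > 0`, form a neighbourhood base at `x`. -/
instance instTopologicalSpaceL0 : TopologicalSpace (L0 P) where
  IsOpen U := ∀ x ∈ U, ∃ ε : L0 P, AEPos ε ∧ ∀ y : L0 P, |y - x| ≤ ε → y ∈ U
  isOpen_univ := fun _ _ => ⟨1, by
    filter_upwards [AEEqFun.coeFn_one (α := Ω) (μ := P) (β := ℝ)] with ω h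
    simp [h], fun _ _ => trivial⟩
  isOpen_inter := by
    rintro U V hU hV x ⟨hxU, hxV⟩
    obtain ⟨ε, hε, h1⟩ := hU x hxU
    obtain ⟨δ, hδ, h2⟩ := hV x hxV
    refine ⟨ε ⊓ δ, ?_, fun y hy =>
      ⟨h1 y (hy.trans inf_le_left), h2 y (hy.trans inf_le_right)⟩⟩
    filter_upwards [hε, hδ, AEEqFun.coeFn_inf ε δ] with ω h3 h4 h5
    rw [h5]
    exact lt_min h3 h4
  isOpen_sUnion := by
    rintro 𝒮 h x ⟨U, hU, hx⟩
    obtain ⟨ε, hε, h1⟩ := h U hU x hx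
    exact ⟨ε, hε, fun y hy => ⟨U, hU, h1 y hy⟩⟩

/-- `1_A` as an element of `L⁰`. -/
def ind (P : Measure Ω) (A : Set Ω) (hA : MeasurableSet A) : L0 P :=
  AEEqFun.mk (A.indicator fun _ => (1 : ℝ))
    ((measurable_const.indicator hA).aestronglyMeasurable)

/-- `r - g` for `r ∈ L⁰` and `g` in the extended `L⁰`; no `∞ - ∞` can occur. -/
def subExt (r : L0 P) (g : L0bar P) : L0bar P :=
  AEEqFun.mk (fun ω => ((r ω : ℝ) : EReal) - g ω) (by
    have h1 : AEMeasurable (fun ω => ((r ω : ℝ) : EReal)) P := r.aemeasurable.coe_real_ereal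
    have h2 : AEMeasurable (fun ω => - g ω) P := g.aemeasurable.neg
    exact (h1.add h2).aestronglyMeasurable)

end Ring

section EssSup

variable {Ω : Type*} [MeasurableSpace Ω] {P : Measure Ω}

/-- The almost sure supremum of a sequence in the extended `L⁰`. -/
def seqSup (u : ℕ → L0bar P) : L0bar P :=
  AEEqFun.mk (fun ω => ⨆ n, u n ω)
    (AEMeasurable.iSup fun n => (u n).aemeasurable).aestronglyMeasurable

theorem le_seqSup (u : ℕ → L0bar P) (n : ℕ) : u n ≤ seqSup u := by
  rw [← AEEqFun.coeFn_le]
  filter_upwards [AEEqFun.coeFn_mk (fun ω => ⨆ n, u n ω)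
    (AEMeasurable.iSup fun n => (u n).aemeasurable).aestronglyMeasurable] with ω h
  exact (le_iSup (fun n => u n ω) n).trans h.ge

theorem seqSup_le {u : ℕ → L0bar P} {g : L0bar P} (h : ∀ n, u n ≤ g) : seqSup u ≤ g := by
  rw [← AEEqFun.coeFn_le]
  have h' : ∀ᵐ ω ∂P, ∀ n, u n ω ≤ g ω := ae_all_iff.2 fun n => AEEqFun.coeFn_le.2 (h n)
  filter_upwards [h', AEEqFun.coeFn_mk (fun ω => ⨆ n, u n ω)
    (AEMeasurable.iSup fun n => (u n).aemeasurable).aestronglyMeasurable] with ω h1 h2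
  exact h2.le.trans (iSup_le h1)

/-- A strictly increasing bounded function on `[-∞, +∞]`. -/
def squash (x : EReal) : ENNReal :=
  (ENNReal.orderIsoIicOneBirational (EReal.expOrderIso x) : ENNReal)

theorem squash_strictMono : StrictMono squash := by
  intro x y h
  have h1 := EReal.expOrderIso.strictMono h
  exact ENNReal.orderIsoIicOneBirational.strictMono h1

theorem squash_le_one (x : EReal) : squash x ≤ 1 :=
  (ENNReal.orderIsoIicOneBirational (EReal.expOrderIso x)).2

/-- Every family in the extended `L⁰` has a least upper bound. -/
theorem exists_isLUB [IsProbabilityMeasure P] (S : Set (L0bar P)) :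
    ∃ g : L0bar P, IsLUB S g := by
  classical
  rcases S.eq_empty_or_nonempty with rfl | ⟨f₀, hf₀⟩
  · refine ⟨AEEqFun.const Ω ⊥, by simp, fun g _ => ?_⟩
    rw [← AEEqFun.coeFn_le]
    filter_upwards [AEEqFun.coeFn_const (μ := P) Ω (⊥ : EReal)] with ω h
    rw [h]
    exact bot_le
  let J : L0bar P → ENNReal := fun g => ∫⁻ ω, squash (g ω) ∂P
  have J_mono : ∀ {g h : L0bar P}, g ≤ h → J g ≤ J h := by
    intro g h hgh
    refine lintegral_mono_ae ?_
    filter_upwards [AEEqFun.coeFn_le.2 hgh] with ω hω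
    exact squash_strictMono.monotone hω
  have J_fin : ∀ g : L0bar P, J g ≠ ⊤ := by
    intro g
    have : J g ≤ ∫⁻ _, 1 ∂P := lintegral_mono fun ω => squash_le_one _
    simp only [lintegral_const, measure_univ, mul_one] at this
    exact (this.trans_lt ENNReal.one_lt_top).ne
  let T : Set ENNReal := {t | ∃ u : ℕ → L0bar P, (∀ n, u n ∈ S) ∧ t = J (seqSup u)}
  have hT : T.Nonempty := ⟨_, fun _ => f₀, fun _ => hf₀, rfl⟩
  obtain ⟨t, -, ht, htT⟩ := exists_seq_tendsto_sSup hT (OrderTop.bddAbove T)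
  choose u huS hut using htT
  let v : ℕ → L0bar P := fun n => u n.unpair.1 n.unpair.2
  have hvS : ∀ n, v n ∈ S := fun n => huS _ _
  have hle : ∀ k, seqSup (u k) ≤ seqSup v := fun k => seqSup_le fun n => by
    have := le_seqSup v (Nat.pair k n)
    simpa [v] using this
  have hmax : sSup T ≤ J (seqSup v) :=
    le_of_tendsto' ht fun k => (hut k).le.trans (J_mono (hle k))
  refine ⟨seqSup v, fun f hf => ?_, fun g hg => seqSup_le fun n => hg (hvS n)⟩
  let w : ℕ → L0bar P := fun n => Nat.casesOn n f v
  have hwS : ∀ n, w n ∈ S := by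
    intro n
    cases n with
    | zero => exact hf
    | succ k => exact hvS k
  have hvw : seqSup v ≤ seqSup w := seqSup_le fun n => le_seqSup w (n + 1)
  have hfw : f ≤ seqSup w := le_seqSup w 0
  have hJ : J (seqSup w) ≤ J (seqSup v) :=
    (le_sSup (show J (seqSup w) ∈ T from ⟨w, hwS, rfl⟩)).trans hmax
  have hmeas : AEMeasurable (fun ω => squash (seqSup w ω)) P :=
    squash_strictMono.monotone.measurable.comp_aemeasurable (seqSup w).aemeasurable
  have hae : (fun ω => squash (seqSup v ω)) =ᵐ[P] fun ω => squash (seqSup w ω) := by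
    refine ae_eq_of_ae_le_of_lintegral_le ?_ (J_fin _) hmeas hJ
    filter_upwards [AEEqFun.coeFn_le.2 hvw] with ω hω
    exact squash_strictMono.monotone hω
  refine hfw.trans ?_
  rw [← AEEqFun.coeFn_le]
  filter_upwards [hae] with ω hω
  exact (squash_strictMono.injective hω).ge

/-- The essential supremum of a family of extended random variables: its least upper bound for
the almost sure order. -/
def esssup [IsProbabilityMeasure P] (S : Set (L0bar P)) : L0bar P :=
  Classical.choose (exists_isLUB S)

theorem isLUB_esssup [IsProbabilityMeasure P] (S : Set (L0bar P)) : IsLUB S (esssup S) :=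
  Classical.choose_spec (exists_isLUB S)

end EssSup

/-- A countable measurable partition of `Ω` (pieces may be empty or null). -/
structure CountablePartition (Ω : Type*) [MeasurableSpace Ω] where
  /-- The pieces. -/
  part : ℕ → Set Ω
  measurableSet_part : ∀ k, MeasurableSet (part k)
  disjoint_part : Pairwise fun i j => Disjoint (part i) (part j)
  iUnion_part : ⋃ k, part k = Set.univ

section Module

variable {Ω : Type*} [MeasurableSpace Ω] (P : Measure Ω)
variable {E : Type*} [AddCommGroup E] [Module (L0 P) E]

/-- `y` is a concatenation of the sequence `x` along the partition `A`:
`1_{A_k} y = 1_{A_k} x_k` for every `k`. -/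
def IsConcat (A : CountablePartition Ω) (x : ℕ → E) (y : E) : Prop :=
  ∀ k, ind P (A.part k) (A.measurableSet_part k) • y =
    ind P (A.part k) (A.measurableSet_part k) • x k

variable (E) in
/-- The countable concatenation property of an `L⁰`-module. -/
def HasCountableConcat : Prop :=
  ∀ (A : CountablePartition Ω) (x : ℕ → E), ∃! y : E, IsConcat P A x y

/-- The set `∑ 1_{A_k} S_k` of all concatenations of sequences `x_k ∈ S_k`. -/
def concatSet (A : CountablePartition Ω) (S : ℕ → Set E) : Set E :=
  {y | ∃ x : ℕ → E, (∀ k, x k ∈ S k) ∧ IsConcat P A x y}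

/-- Non-empty and closed under countable concatenations. -/
def IsStable (S : Set E) : Prop :=
  S.Nonempty ∧ ∀ (A : CountablePartition Ω) (x : ℕ → E) (y : E),
    (∀ k, x k ∈ S) → IsConcat P A x y → y ∈ S

/-- A stable collection of subsets. -/
def IsStableCollection (𝒞 : Set (Set E)) : Prop :=
  𝒞.Nonempty ∧ (∀ S ∈ 𝒞, IsStable P S) ∧
    ∀ (A : CountablePartition Ω) (S : ℕ → Set E), (∀ k, S k ∈ 𝒞) → concatSet P A S ∈ 𝒞

/-- `L⁰`-convex sets. -/
def IsL0Convex (S : Set E) : Prop :=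
  ∀ x ∈ S, ∀ y ∈ S, ∀ η : L0 P, 0 ≤ η → η ≤ 1 → η • x + (1 - η) • y ∈ S

/-- `L⁰`-absorbing sets: every `x` lies in `η S` for some `η > 0`. -/
def IsL0Absorbing (S : Set E) : Prop :=
  ∀ x : E, ∃ η : L0 P, AEPos η ∧ ∃ s ∈ S, x = η • s

/-- `L⁰`-balanced sets. -/
def IsL0Balanced (S : Set E) : Prop :=
  ∀ x ∈ S, ∀ η : L0 P, |η| ≤ 1 → η • x ∈ S

variable (E) in
/-- `E` is a stable locally `L⁰`-convex module: a topological `L⁰`-module with the countable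
concatenation property and a neighbourhood base of `0` which is a stable collection of `L⁰`-convex,
`L⁰`-absorbing, `L⁰`-balanced sets. -/
structure IsStableLocallyL0Convex [TopologicalSpace E] : Prop where
  continuous_add : Continuous fun p : E × E => p.1 + p.2
  continuous_smul : Continuous fun p : L0 P × E => p.1 • p.2
  concat : HasCountableConcat P E
  exists_base : ∃ 𝒰 : Set (Set E), (𝓝 (0 : E)).HasBasis (fun U => U ∈ 𝒰) (fun U => U) ∧
    IsStableCollection P 𝒰 ∧
    ∀ U ∈ 𝒰, IsL0Convex P U ∧ IsL0Absorbing P U ∧ IsL0Balanced P U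

/-- `f(ηx + (1-η)y) ≤ η f(x) + (1-η) f(y)` for `0 ≤ η ≤ 1` in `L⁰`, almost surely, with the
convention `0 · (±∞) = 0`. -/
def IsL0ConvexFun (f : E → L0bar P) : Prop :=
  ∀ (x y : E) (η : L0 P), 0 ≤ η → η ≤ 1 →
    ∀ᵐ ω ∂P, f (η • x + (1 - η) • y) ω ≤
      ((η ω : ℝ) : EReal) * f x ω + ((1 - η ω : ℝ) : EReal) * f y ω

/-- `f > -∞` everywhere and `f` has a value in `L⁰`. -/
def IsProper (f : E → L0bar P) : Prop :=
  (∀ x, ∀ᵐ ω ∂P, ⊥ < f x ω) ∧ ∃ (x₀ : E) (r : L0 P), ∀ᵐ ω ∂P, f x₀ ω = ((r ω : ℝ) : EReal)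

/-- All sublevel sets, at levels in the extended `L⁰`, are closed. -/
def IsLsc [TopologicalSpace E] (f : E → L0bar P) : Prop :=
  ∀ η : L0bar P, IsClosed {x : E | f x ≤ η}

/-- The topological dual `E*`: continuous `L⁰`-linear maps `E → L⁰`. -/
abbrev Dual (E : Type*) [AddCommGroup E] [Module (L0 P) E] [TopologicalSpace E] : Type _ :=
  E →L[L0 P] L0 P

/-- The conjugate `f*(μ) = esssup_x (μ(x) - f(x))`. -/
def conj [IsProbabilityMeasure P] [TopologicalSpace E] (f : E → L0bar P) : Dual P E → L0bar P :=
  fun μ => esssup (Set.range fun x : E => subExt (μ x) (f x))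

/-- The biconjugate `f**(x) = esssup_μ (μ(x) - f*(μ))`. -/
def biconj [IsProbabilityMeasure P] [TopologicalSpace E] (f : E → L0bar P) : E → L0bar P :=
  fun x => esssup (Set.range fun μ : Dual P E => subExt (μ x) (conj P f μ))

end Module

end

end L0Mod

namespace L0Mod

noncomputable section

/-! ### Order structure of `L⁰`: positive units and order completeness. -/

section OrderedRing

variable {Ω : Type*} [MeasurableSpace Ω] {P : Measure Ω}

/-! The inequality `f** ≤ f` is Young–Fenchel (`biconj_le`). For the converse it suffices to find,
for each `x₀` and each finite `β < f x₀`, a continuous affine minorant of `f` with value `β` at `x₀`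
(`toBar_le_biconj`, `le_of_forall_toBar_le`).

Closedness of a sublevel set only says that an inequality fails on some non-null event. Locality of
convex functions, exhaustion and stability of the base glue these local statements into one basic
`U` with `β ≤ f` on `x₀ + U` (`exists_basic_forall_le`). The same argument bounds `f` below near a
point `x₁` where it is finite, and convexity combines both bounds into `f (x₀ + η u) - β ≥ -K η`
(`exists_neg_mul_le`).

This linear growth excludes vertical hyperplanes: the infimum of `t r + K η` over `y = t x + η u`
with `f (x₀ + x) - β ≤ r` is a finite sublinear map, and a linear map below it is the required slope
(`exists_linearMap_le_of_convex`). It is bounded above on `U`, hence continuous. Hahn–Banach itself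
takes a minimal sublinear map by Zorn and shows that it is additive. Since `L⁰` has zero divisors,
scalars are kept strictly positive, hence invertible. -/

instance instIsOrderedAddMonoidL0 : IsOrderedAddMonoid (L0 P) where
  add_le_add_left a b hab c := by
    rw [← AEEqFun.coeFn_le] at hab ⊢
    filter_upwards [hab, AEEqFun.coeFn_add a c, AEEqFun.coeFn_add b c] with ω h1 h2 h3
    rw [h2, h3]
    simpa using h1

theorem L0.mul_nonneg {a b : L0 P} (ha : 0 ≤ a) (hb : 0 ≤ b) : 0 ≤ a * b := by
  rw [← AEEqFun.coeFn_le] at ha hb ⊢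
  filter_upwards [ha, hb, AEEqFun.coeFn_mul a b,
    AEEqFun.coeFn_zero (α := Ω) (μ := P) (β := ℝ)] with ω h1 h2 h3 h4
  rw [h4] at h1 h2 ⊢
  rw [h3]
  exact _root_.mul_nonneg h1 h2

instance instZeroLEOneClassL0 : ZeroLEOneClass (L0 P) where
  zero_le_one := by
    rw [← AEEqFun.coeFn_le]
    filter_upwards [AEEqFun.coeFn_zero (α := Ω) (μ := P) (β := ℝ),
      AEEqFun.coeFn_one (α := Ω) (μ := P) (β := ℝ)] with ω h1 h2
    rw [h1, h2]
    exact zero_le_one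

instance instIsOrderedRingL0 : IsOrderedRing (L0 P) :=
  .of_mul_nonneg fun _ _ => L0.mul_nonneg

namespace AEPos

variable {a b : L0 P}

theorem nonneg (ha : AEPos a) : 0 ≤ a := by
  rw [← AEEqFun.coeFn_le]
  filter_upwards [ha, AEEqFun.coeFn_zero (α := Ω) (μ := P) (β := ℝ)] with ω h1 h2
  rw [h2]
  exact h1.le

theorem mono (ha : AEPos a) (hab : a ≤ b) : AEPos b := by
  rw [← AEEqFun.coeFn_le] at hab
  filter_upwards [ha, hab] with ω h1 h2
  exact h1.trans_le h2

protected theorem one : AEPos (1 : L0 P) := by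
  filter_upwards [AEEqFun.coeFn_one (α := Ω) (μ := P) (β := ℝ)] with ω h
  simp [h]

theorem add_nonneg (ha : AEPos a) (hb : 0 ≤ b) : AEPos (a + b) :=
  ha.mono (le_add_of_nonneg_right hb)

protected theorem add (ha : AEPos a) (hb : AEPos b) : AEPos (a + b) := ha.add_nonneg hb.nonneg

protected theorem mul (ha : AEPos a) (hb : AEPos b) : AEPos (a * b) := by
  filter_upwards [ha, hb, AEEqFun.coeFn_mul a b] with ω h1 h2 h3
  rw [h3]
  exact mul_pos h1 h2

theorem exists_inv (ha : AEPos a) : ∃ b : L0 P, AEPos b ∧ a * b = 1 := by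
  have h := AEEqFun.coeFn_compMeasurable (fun x : ℝ => x⁻¹) measurable_inv a
  refine ⟨AEEqFun.compMeasurable (fun x : ℝ => x⁻¹) measurable_inv a, ?_, ?_⟩
  · filter_upwards [ha, h] with ω h1 h2
    rw [h2]
    exact inv_pos.2 h1
  · apply AEEqFun.ext
    filter_upwards [ha, h, AEEqFun.coeFn_one (α := Ω) (μ := P) (β := ℝ),
      AEEqFun.coeFn_mul a (AEEqFun.compMeasurable (fun x : ℝ => x⁻¹) measurable_inv a)]
      with ω h1 h2 h3 h4
    rw [h4, h3, Pi.mul_apply, h2]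
    exact mul_inv_cancel₀ h1.ne'

theorem le_of_mul_le_mul_left {c : L0 P} (hc : AEPos c) (h : c * a ≤ c * b) : a ≤ b := by
  obtain ⟨d, hd, hcd⟩ := hc.exists_inv
  calc a = d * (c * a) := by linear_combination (-a) * hcd
    _ ≤ d * (c * b) := mul_le_mul_of_nonneg_left h hd.nonneg
    _ = b := by linear_combination b * hcd

end AEPos

/-- Archimedean property: a bound up to every positive multiple of a fixed element is a bound. -/
theorem le_of_forall_le_add_mul {a b c : L0 P} (h : ∀ ε : L0 P, AEPos ε → a ≤ b + c * ε) :
    a ≤ b := by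
  -- Countably many constants suffice, so one null set serves all `n` and the limit is taken
  -- pointwise.
  let e : ℕ → L0 P := fun n => AEEqFun.const Ω (1 / ((n : ℝ) + 1))
  have he : ∀ n, ∀ᵐ ω ∂P, e n ω = 1 / ((n : ℝ) + 1) := fun n => AEEqFun.coeFn_const Ω _
  have hpos : ∀ n, AEPos (e n) := fun n => by
    filter_upwards [he n] with ω hω
    rw [hω]
    positivity
  have key : ∀ n : ℕ, ∀ᵐ ω ∂P, a ω ≤ b ω + c ω * (1 / ((n : ℝ) + 1)) := fun n => by
    filter_upwards [AEEqFun.coeFn_le.2 (h (e n) (hpos n)), he n, AEEqFun.coeFn_add b (c * e n),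
      AEEqFun.coeFn_mul c (e n)] with ω h1 h2 h3 h4
    rw [h3, Pi.add_apply, h4, Pi.mul_apply, h2] at h1
    exact h1
  rw [← AEEqFun.coeFn_le]
  filter_upwards [ae_all_iff.2 key] with ω hω
  have hlim : Filter.Tendsto (fun n : ℕ => b ω + c ω * (1 / ((n : ℝ) + 1))) Filter.atTop
      (𝓝 (b ω + c ω * 0)) :=
    (tendsto_one_div_add_atTop_nhds_zero_nat.const_mul _).const_add _
  simpa using ge_of_tendsto' hlim hω

/-- `L⁰` inside the extended `L⁰`. -/
def toBar (a : L0 P) : L0bar P :=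
  AEEqFun.compMeasurable (fun x : ℝ => (x : EReal)) measurable_coe_real_ereal a

theorem coeFn_toBar (a : L0 P) : ∀ᵐ ω ∂P, toBar a ω = ((a ω : ℝ) : EReal) :=
  AEEqFun.coeFn_compMeasurable _ _ _

theorem toBar_le_toBar {a b : L0 P} : toBar a ≤ toBar b ↔ a ≤ b := by
  rw [← AEEqFun.coeFn_le, ← AEEqFun.coeFn_le]
  constructor <;> intro h <;> filter_upwards [h, coeFn_toBar a, coeFn_toBar b] with ω h1 h2 h3
  · rwa [h2, h3, EReal.coe_le_coe_iff] at h1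
  · rwa [h2, h3, EReal.coe_le_coe_iff]

/-- Order completeness of `L⁰`. -/
theorem exists_isLUB_of_bddAbove [IsProbabilityMeasure P] {S : Set (L0 P)} (hne : S.Nonempty)
    (hbd : BddAbove S) : ∃ g, IsLUB S g := by
  obtain ⟨G, hG⟩ := exists_isLUB (toBar '' S)
  obtain ⟨s, hs⟩ := hne
  obtain ⟨b, hb⟩ := hbd
  have hsG : toBar s ≤ G := hG.1 ⟨s, hs, rfl⟩
  have hGb : G ≤ toBar b := hG.2 (by
    rintro _ ⟨x, hx, rfl⟩
    exact toBar_le_toBar.2 (hb hx))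
  -- `G` lies between `toBar s` and `toBar b`, so it is finite and `toReal` loses nothing.
  let g : L0 P := AEEqFun.compMeasurable EReal.toReal measurable_ereal_toReal G
  have hg : toBar g = G := by
    apply AEEqFun.ext
    filter_upwards [coeFn_toBar g,
      AEEqFun.coeFn_compMeasurable EReal.toReal measurable_ereal_toReal G,
      AEEqFun.coeFn_le.2 hsG, AEEqFun.coeFn_le.2 hGb, coeFn_toBar s, coeFn_toBar b]
      with ω h1 h2 h3 h4 h5 h6
    rw [h1, h2]
    refine EReal.coe_toReal ?_ ?_
    · rintro h
      rw [h, h6] at h4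
      exact EReal.coe_ne_top _ (top_le_iff.1 h4)
    · rintro h
      rw [h, h5] at h3
      exact EReal.coe_ne_bot _ (le_bot_iff.1 h3)
  refine ⟨g, fun x hx => ?_, fun c hc => ?_⟩
  · rw [← toBar_le_toBar, hg]
    exact hG.1 ⟨x, hx, rfl⟩
  · rw [← toBar_le_toBar, hg]
    refine hG.2 ?_
    rintro _ ⟨x, hx, rfl⟩
    exact toBar_le_toBar.2 (hc hx)

theorem exists_isGLB_of_bddBelow [IsProbabilityMeasure P] {S : Set (L0 P)} (hne : S.Nonempty)
    (hbd : BddBelow S) : ∃ g, IsGLB S g := by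
  obtain ⟨g, hg⟩ := exists_isLUB_of_bddAbove (S := -S) hne.neg (bddAbove_neg.2 hbd)
  exact ⟨-g, isLUB_neg.1 hg⟩

end OrderedRing

/-! ### Hahn–Banach over `L⁰` through minimal sublinear maps. -/

section HahnBanach

variable {Ω : Type*} [MeasurableSpace Ω] {P : Measure Ω}
variable {E : Type*} [AddCommGroup E] [Module (L0 P) E]

/-- `L⁰`-sublinear maps; homogeneity is only required for invertible positive scalars. -/
structure IsSublinear (T : E → L0 P) : Prop where
  map_add_le : ∀ x y, T (x + y) ≤ T x + T y
  map_smul_le : ∀ (t : L0 P) (x : E), AEPos t → T (t • x) ≤ t * T x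

namespace IsSublinear

variable {T : E → L0 P}

theorem map_smul (hT : IsSublinear T) {t : L0 P} (ht : AEPos t) (x : E) :
    T (t • x) = t * T x := by
  refine le_antisymm (hT.map_smul_le t x ht) ?_
  obtain ⟨s, hs, hts⟩ := ht.exists_inv
  have h := hT.map_smul_le s (t • x) hs
  rw [smul_smul, mul_comm s t, hts, one_smul] at h
  calc t * T x ≤ t * (s * T (t • x)) := mul_le_mul_of_nonneg_left h ht.nonneg
    _ = T (t • x) := by linear_combination T (t • x) * hts

theorem map_zero (hT : IsSublinear T) : T 0 = 0 := by
  have h := hT.map_smul (AEPos.one.add AEPos.one) 0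
  rw [smul_zero] at h
  linear_combination -h

theorem neg_map_neg_le (hT : IsSublinear T) (x : E) : -T (-x) ≤ T x := by
  have h := hT.map_add_le x (-x)
  rw [add_neg_cancel, hT.map_zero] at h
  exact neg_le_iff_add_nonneg.2 h

/-- An additive sublinear map is linear. -/
theorem exists_linearMap_eq (hT : IsSublinear T) (hadd : ∀ x y, T (x + y) = T x + T y) :
    ∃ μ : E →ₗ[L0 P] L0 P, ∀ x, μ x = T x := by
  refine ⟨⟨⟨T, hadd⟩, fun t x => ?_⟩, fun _ => rfl⟩
  -- An arbitrary `t` is the difference of the positive units `1 + |t| + t` and `1 + |t|`;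
  -- additivity then extends homogeneity to it.
  have h1 : AEPos (1 + |t|) := AEPos.one.add_nonneg (abs_nonneg t)
  have h2 : AEPos (1 + |t| + t) := by
    have : (1 : L0 P) ≤ 1 + |t| + t := by
      rw [add_assoc]
      exact le_add_of_nonneg_right (neg_le_iff_add_nonneg.1 (neg_le_abs t))
    exact AEPos.one.mono this
  have h3 := hadd ((1 + |t|) • x) (t • x)
  rw [← add_smul, hT.map_smul h1, hT.map_smul h2] at h3
  change T (t • x) = t * T x
  linear_combination -h3

/-- The infimum of a non-empty chain of sublinear maps with a sublinear bound. -/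
theorem exists_lowerBound_of_isChain [IsProbabilityMeasure P] {S : E → L0 P}
    {c : Set (E → L0 P)} (hcS : ∀ T ∈ c, IsSublinear T ∧ T ≤ S) (hc : IsChain (· ≤ ·) c)
    (hne : c.Nonempty) : ∃ L : E → L0 P, IsSublinear L ∧ ∀ T ∈ c, L ≤ T := by
  have hglb : ∀ x, ∃ g, IsGLB ((fun T : E → L0 P => T x) '' c) g := fun x => by
    refine exists_isGLB_of_bddBelow (hne.image _) ⟨-S (-x), ?_⟩
    rintro _ ⟨T, hT, rfl⟩
    exact (neg_le_neg ((hcS T hT).2 (-x))).trans ((hcS T hT).1.neg_map_neg_le x)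
  choose L hL using hglb
  have hLT : ∀ T ∈ c, ∀ x, L x ≤ T x := fun T hT x => (hL x).1 ⟨T, hT, rfl⟩
  refine ⟨L, ⟨fun x y => ?_, fun t x ht => ?_⟩, hLT⟩
  · rw [← sub_le_iff_le_add]
    refine (hL x).2 ?_
    rintro _ ⟨T, hT, rfl⟩
    rw [sub_le_comm]
    refine (hL y).2 ?_
    rintro _ ⟨R, hR, rfl⟩
    rw [sub_le_iff_le_add']
    -- The smaller of two comparable members estimates both terms.
    rcases hc.total hT hR with h | h
    · exact (hLT T hT _).trans (((hcS T hT).1.map_add_le x y).trans (add_le_add le_rfl (h y)))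
    · exact (hLT R hR _).trans (((hcS R hR).1.map_add_le x y).trans (add_le_add (h x) le_rfl))
  · obtain ⟨s, hs, hts⟩ := ht.exists_inv
    have h : s * L (t • x) ≤ L x := by
      refine (hL x).2 ?_
      rintro _ ⟨T, hT, rfl⟩
      calc s * L (t • x) ≤ s * (t * T x) := mul_le_mul_of_nonneg_left
            ((hLT T hT _).trans ((hcS T hT).1.map_smul_le t x ht)) hs.nonneg
        _ = T x := by linear_combination T x * hts
    calc L (t • x) = t * (s * L (t • x)) := by linear_combination -L (t • x) * hts
      _ ≤ t * L x := mul_le_mul_of_nonneg_left h ht.nonneg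

/-- A minimal sublinear map is additive. -/
theorem map_add_of_minimal [IsProbabilityMeasure P] (hT : IsSublinear T)
    (hmin : ∀ R : E → L0 P, IsSublinear R → R ≤ T → T ≤ R) (x a : E) :
    T (x + a) = T x + T a := by
  -- The infimum `R` of these values is sublinear and below `T`, so minimality gives `T ≤ R`; the
  -- value at `t = 1` is then the missing superadditivity.
  let V : E → Set (L0 P) := fun x => {v | ∃ t : L0 P, AEPos t ∧ v = T (x + t • a) - t * T a}
  have hglb : ∀ x, ∃ g, IsGLB (V x) g := fun x => by
    refine exists_isGLB_of_bddBelow ⟨_, 1, AEPos.one, rfl⟩ ⟨-T (-x), ?_⟩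
    rintro _ ⟨t, ht, rfl⟩
    have h := hT.map_add_le (x + t • a) (-x)
    rw [add_comm x, add_neg_cancel_right, hT.map_smul ht, add_comm (t • a)] at h
    rw [← sub_nonneg] at h ⊢
    convert h using 1
    ring
  choose R hR using hglb
  have hRT : ∀ (x : E) (t : L0 P), AEPos t → R x ≤ T (x + t • a) - t * T a :=
    fun x t ht => (hR x).1 ⟨t, ht, rfl⟩
  have hR1 : IsSublinear R := by
    refine ⟨fun x y => ?_, fun t x ht => ?_⟩
    · rw [← sub_le_iff_le_add]
      refine (hR x).2 ?_
      rintro _ ⟨t, ht, rfl⟩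
      rw [sub_le_comm]
      refine (hR y).2 ?_
      rintro _ ⟨s, hs, rfl⟩
      have h1 := hRT (x + y) (t + s) (ht.add hs)
      have h2 := hT.map_add_le (x + t • a) (y + s • a)
      rw [show x + t • a + (y + s • a) = x + y + (t + s) • a by module] at h2
      have h3 := add_le_add h1 h2
      rw [← sub_nonneg] at h3 ⊢
      convert h3 using 1
      ring
    · obtain ⟨s, hs, hts⟩ := ht.exists_inv
      have h : s * R (t • x) ≤ R x := by
        refine (hR x).2 ?_
        rintro _ ⟨r, hr, rfl⟩
        have h1 := hRT (t • x) (t * r) (ht.mul hr)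
        rw [mul_smul, ← smul_add, hT.map_smul ht] at h1
        calc s * R (t • x) ≤ s * (t * T (x + r • a) - t * r * T a) :=
              mul_le_mul_of_nonneg_left h1 hs.nonneg
          _ = T (x + r • a) - r * T a := by
              linear_combination (T (x + r • a) - r * T a) * hts
      calc R (t • x) = t * (s * R (t • x)) := by linear_combination -R (t • x) * hts
        _ ≤ t * R x := mul_le_mul_of_nonneg_left h ht.nonneg
  have hle : R ≤ T := fun x => by
    refine (hRT x 1 AEPos.one).trans ?_
    rw [one_smul, one_mul, sub_le_iff_le_add]
    exact hT.map_add_le x a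
  refine le_antisymm (hT.map_add_le x a) ?_
  have h := (hmin R hR1 hle x).trans (hRT x 1 AEPos.one)
  rwa [one_smul, one_mul, le_sub_iff_add_le] at h

/-- Hahn–Banach: every sublinear map dominates a linear one. -/
theorem exists_linearMap_le [IsProbabilityMeasure P] {S : E → L0 P} (hS : IsSublinear S) :
    ∃ μ : E →ₗ[L0 P] L0 P, ∀ x, μ x ≤ S x := by
  obtain ⟨T, -, hT, hmin⟩ := zorn_le_nonempty₀ (α := (E → L0 P)ᵒᵈ)
    {T | IsSublinear (OrderDual.ofDual T) ∧ OrderDual.ofDual T ≤ S}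
    (fun c hcS hc T hT => by
      obtain ⟨L, hL, hLc⟩ := exists_lowerBound_of_isChain (S := S) (c := c)
        (fun T hT => hcS hT) hc.symm ⟨T, hT⟩
      exact ⟨L, ⟨hL, (hLc T hT).trans (hcS hT).2⟩, hLc⟩)
    (OrderDual.toDual S) ⟨hS, le_rfl⟩
  obtain ⟨μ, hμ⟩ := hT.1.exists_linearMap_eq
    (hT.1.map_add_of_minimal fun R hR hRT => hmin ⟨hR, le_trans hRT hT.2⟩ hRT)
  exact ⟨μ, fun x => (hμ x).trans_le (hT.2 x)⟩

end IsSublinear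

end HahnBanach

/-! ### A linear map below a convex relation. -/

section Sandwich

variable {Ω : Type*} [MeasurableSpace Ω] {P : Measure Ω}
variable {E : Type*} [AddCommGroup E] [Module (L0 P) E] {U : Set E}

theorem IsL0Balanced.neg_mem (hU : IsL0Balanced P U) {u : E} (hu : u ∈ U) : -u ∈ U := by
  have h := hU u hu (-1) (by rw [abs_neg, abs_of_nonneg zero_le_one])
  rwa [neg_one_smul] at h

theorem IsL0Balanced.zero_mem (hU : IsL0Balanced P U) (hne : U.Nonempty) : (0 : E) ∈ U := by
  obtain ⟨u, hu⟩ := hne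
  have h := hU u hu 0 (by rw [abs_zero]; exact zero_le_one)
  rwa [zero_smul] at h

/-- The weights of a convex combination proportional to two positive elements. -/
theorem exists_weight {a b : L0 P} (ha : AEPos a) (hb : AEPos b) :
    ∃ η : L0 P, 0 ≤ η ∧ η ≤ 1 ∧ (a + b) * η = a ∧ (a + b) * (1 - η) = b := by
  obtain ⟨s, hs, hts⟩ := (ha.add hb).exists_inv
  refine ⟨a * s, (ha.mul hs).nonneg, ?_, ?_, ?_⟩
  · rw [← hts, add_mul]
    exact le_add_of_nonneg_right (hb.mul hs).nonneg
  · linear_combination a * hts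
  · linear_combination -a * hts

theorem IsL0Convex.exists_smul_add_smul (hU : IsL0Convex P U) {a b : L0 P} (ha : AEPos a)
    (hb : AEPos b) {u v : E} (hu : u ∈ U) (hv : v ∈ U) :
    ∃ w ∈ U, a • u + b • v = (a + b) • w := by
  obtain ⟨η, h0, h1, h2, h3⟩ := exists_weight ha hb
  refine ⟨_, hU u hu v hv η h0 h1, ?_⟩
  rw [smul_add, smul_smul, smul_smul, h2, h3]

/-- Sandwich theorem: if a convex relation `C x r` (think `f x ≤ r`) forces `r ≥ -Kη` for
`x ∈ ηU`, then some linear map lies below `C` and is bounded above on `U`. -/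
theorem exists_linearMap_le_of_convex [IsProbabilityMeasure P] (hUc : IsL0Convex P U)
    (hUa : IsL0Absorbing P U) (hUb : IsL0Balanced P U) {C : E → L0 P → Prop}
    (hC : ∀ x r y s (η : L0 P), C x r → C y s → 0 ≤ η → η ≤ 1 →
      C (η • x + (1 - η) • y) (η * r + (1 - η) * s))
    {K : L0 P} (hlow : ∀ r (η : L0 P), ∀ u ∈ U, AEPos η → C (η • u) r → -(K * η) ≤ r)
    (hne : ∃ x r, C x r) :
    ∃ μ : E →ₗ[L0 P] L0 P, (∀ x r, C x r → μ x ≤ r) ∧ ∃ M : L0 P, ∀ u ∈ U, μ u ≤ M := by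
  obtain ⟨x₁, r₁, h₁⟩ := hne
  -- The infimum combines the conical hull of `C` with `K` times the gauge of `U`.
  let V : E → Set (L0 P) := fun y => {v | ∃ (t η : L0 P) (x : E) (r : L0 P) (u : E),
    AEPos t ∧ AEPos η ∧ u ∈ U ∧ C x r ∧ y = t • x + η • u ∧ v = t * r + K * η}
  have hglb : ∀ y, ∃ g, IsGLB (V y) g := fun y => by
    refine exists_isGLB_of_bddBelow ?_ ?_
    · obtain ⟨η, hη, u, hu, hyu⟩ := hUa (y - x₁)
      refine ⟨_, 1, η, x₁, r₁, u, AEPos.one, hη, hu, h₁, ?_, rfl⟩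
      rw [← hyu, one_smul]
      abel
    -- With `y = θ w`, the vector `t x = θ w - η u` lies in `(θ + η) U`, so `hlow` gives `t r ≥ -K
    -- (θ + η)`.
    · obtain ⟨θ, hθ, w, hw, hyw⟩ := hUa y
      refine ⟨-(K * θ), ?_⟩
      rintro _ ⟨t, η, x, r, u, ht, hη, hu, hxr, hy, rfl⟩
      obtain ⟨z, hz, hwz⟩ := hUc.exists_smul_add_smul hθ hη hw (hUb.neg_mem hu)
      obtain ⟨s, hs, hts⟩ := ht.exists_inv
      have hx : x = (s * (θ + η)) • z := by
        have h2 : t • x = (θ + η) • z := by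
          rw [← hwz, ← hyw, hy, smul_neg]
          abel
        rw [mul_smul, ← h2, smul_smul, mul_comm, hts, one_smul]
      have h3 := mul_le_mul_of_nonneg_left
        (hlow r (s * (θ + η)) z hz (hs.mul (hθ.add hη)) (hx ▸ hxr)) ht.nonneg
      rw [← sub_nonneg] at h3 ⊢
      convert h3 using 1
      linear_combination (-K * (θ + η)) * hts
  choose S hS using hglb
  have hSle : ∀ {t η : L0 P} {x : E} {r : L0 P} {u : E}, AEPos t → AEPos η → u ∈ U → C x r →
      S (t • x + η • u) ≤ t * r + K * η := fun ht hη hu hx =>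
    (hS _).1 ⟨_, _, _, _, _, ht, hη, hu, hx, rfl, rfl⟩
  have hsub : IsSublinear S := by
    refine ⟨fun y₁ y₂ => ?_, fun q y hq => ?_⟩
    · rw [← sub_le_iff_le_add]
      refine (hS y₁).2 ?_
      rintro _ ⟨t, η, x, r, u, ht, hη, hu, hx, rfl, rfl⟩
      rw [sub_le_comm]
      refine (hS y₂).2 ?_
      rintro _ ⟨t', η', x', r', u', ht', hη', hu', hx', rfl, rfl⟩
      rw [sub_le_iff_le_add']
      obtain ⟨z, hz, huz⟩ := hUc.exists_smul_add_smul hη hη' hu hu'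
      obtain ⟨θ, h0, h1, h2, h3⟩ := exists_weight ht ht'
      have h := hSle (ht.add ht') (hη.add hη') hz (hC _ _ _ _ θ hx hx' h0 h1)
      rw [smul_add, smul_smul, smul_smul, h2, h3, ← huz] at h
      rw [show t • x + η • u + (t' • x' + η' • u') = t • x + t' • x' + (η • u + η' • u') by abel]
      refine h.trans (le_of_eq ?_)
      linear_combination r * h2 + r' * h3
    · obtain ⟨s, hs, hts⟩ := hq.exists_inv
      have h : s * S (q • y) ≤ S y := by
        refine (hS y).2 ?_
        rintro _ ⟨t, η, x, r, u, ht, hη, hu, hx, rfl, rfl⟩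
        have h := hSle (hq.mul ht) (hq.mul hη) hu hx
        rw [mul_smul, mul_smul, ← smul_add] at h
        calc s * S (q • (t • x + η • u)) ≤ s * (q * t * r + K * (q * η)) :=
              mul_le_mul_of_nonneg_left h hs.nonneg
          _ = t * r + K * η := by linear_combination (t * r + K * η) * hts
      calc S (q • y) = q * (s * S (q • y)) := by linear_combination -S (q • y) * hts
        _ ≤ q * S y := mul_le_mul_of_nonneg_left h hq.nonneg
  obtain ⟨μ, hμ⟩ := hsub.exists_linearMap_le
  obtain ⟨θ, hθ, w, hw, hxw⟩ := hUa x₁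
  -- Writing `x = 1 • x + ε • 0` gives `μ x ≤ r + K ε`. The bound `M` comes from `u = x₁ + (u - x₁)`
  -- with `u - x₁ ∈ (1 + θ) U`.
  refine ⟨μ, fun x r hx => le_of_forall_le_add_mul (c := K) fun ε hε => ?_,
    r₁ + K * (1 + θ), fun u hu => ?_⟩
  · have h := hSle AEPos.one hε (hUb.zero_mem ⟨w, hw⟩) hx
    rw [one_smul, smul_zero, add_zero, one_mul] at h
    exact (hμ x).trans h
  · obtain ⟨z, hz, huz⟩ := hUc.exists_smul_add_smul AEPos.one hθ hu (hUb.neg_mem hw)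
    have h := hSle AEPos.one (AEPos.one.add hθ) hz h₁
    rw [← huz, hxw, one_smul, one_smul, one_mul, smul_neg,
      show θ • w + (u + -(θ • w)) = u by abel] at h
    exact (hμ u).trans h

end Sandwich

/-! ### Essential unions and measurable partitions. -/

section Exhaustion

variable {Ω : Type*} [MeasurableSpace Ω] {P : Measure Ω}

/-- A family of measurable sets has a countable subfamily with the same essential union. -/
theorem exists_seq_measure_diff_iUnion_eq_zero [IsFiniteMeasure P] {ι : Type*} [Nonempty ι]
    {g : ι → Set Ω} (hg : ∀ i, MeasurableSet (g i)) :
    ∃ u : ℕ → ι, ∀ i, P (g i \ ⋃ n, g (u n)) = 0 := by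
  let T : Set ENNReal := Set.range fun u : ℕ → ι => P (⋃ n, g (u n))
  obtain ⟨t, -, ht, htT⟩ := exists_seq_tendsto_sSup (Set.range_nonempty _ : T.Nonempty)
    (OrderTop.bddAbove T)
  choose u hu using htT
  let v : ℕ → ι := fun n => u n.unpair.1 n.unpair.2
  have hle : ∀ k, ⋃ n, g (u k n) ⊆ ⋃ n, g (v n) := fun k =>
    Set.iUnion_subset fun n => by
      have := Set.subset_iUnion (fun n => g (v n)) (Nat.pair k n)
      simpa [v] using this
  have hmax : sSup T ≤ P (⋃ n, g (v n)) :=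
    le_of_tendsto' ht fun k => (hu k).ge.trans (measure_mono (hle k))
  refine ⟨v, fun i => ?_⟩
  -- `v` already attains the maximal measure, so adjoining `g i` to its union adds only a null set.
  let w : ℕ → ι := fun n => Nat.casesOn n i v
  have hvw : ⋃ n, g (v n) ⊆ ⋃ n, g (w n) :=
    Set.iUnion_subset fun n => Set.subset_iUnion (fun n => g (w n)) (n + 1)
  have hiw : g i ⊆ ⋃ n, g (w n) := Set.subset_iUnion (fun n => g (w n)) 0
  have hwT : P (⋃ n, g (w n)) ≤ P (⋃ n, g (v n)) := (le_sSup (Set.mem_range_self w)).trans hmax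
  refine measure_mono_null (Set.sdiff_subset_sdiff_left hiw) ?_
  rw [measure_sdiff hvw (MeasurableSet.iUnion fun n => hg _).nullMeasurableSet
    (measure_ne_top P _), tsub_eq_zero_of_le hwT]

/-- A sequence of measurable sets refined to a partition, with the complement of the union as
first piece. -/
theorem exists_countablePartition {B : ℕ → Set Ω} (hB : ∀ n, MeasurableSet (B n)) :
    ∃ A : CountablePartition Ω, (∀ n, A.part (n + 1) ⊆ B n) ∧
      ∀ ω ∈ ⋃ n, B n, ∃ n, ω ∈ A.part (n + 1) := by
  let C : ℕ → Set Ω := fun n => Nat.casesOn n (⋃ n, B n)ᶜ B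
  have hC : ∀ n, MeasurableSet (C n) := by
    rintro (_ | n)
    · exact (MeasurableSet.iUnion hB).compl
    · exact hB n
  have hun : ⋃ n, disjointed C n = Set.univ := by
    rw [iUnion_disjointed, Set.eq_univ_iff_forall]
    intro ω
    by_cases h : ω ∈ ⋃ n, B n
    · obtain ⟨n, hn⟩ := Set.mem_iUnion.1 h
      exact Set.mem_iUnion.2 ⟨n + 1, hn⟩
    · exact Set.mem_iUnion.2 ⟨0, h⟩
  refine ⟨⟨disjointed C, fun n => MeasurableSet.disjointed hC n, disjoint_disjointed C, hun⟩,
    fun n => disjointed_subset C (n + 1), fun ω hω => ?_⟩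
  obtain ⟨n, hn⟩ := Set.mem_iUnion.1 (hun.ge (Set.mem_univ ω))
  rcases n with _ | n
  · exact absurd hω (disjointed_subset C 0 hn)
  · exact ⟨n, hn⟩

end Exhaustion

/-! ### Locality of convex functions. -/

section Locality

variable {Ω : Type*} [MeasurableSpace Ω] {P : Measure Ω}
variable {E : Type*} [AddCommGroup E] [Module (L0 P) E] {f : E → L0bar P}

theorem coeFn_ind {A : Set Ω} (hA : MeasurableSet A) :
    ∀ᵐ ω ∂P, ind P A hA ω = A.indicator (fun _ => (1 : ℝ)) ω :=
  AEEqFun.coeFn_mk _ _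

theorem ind_nonneg {A : Set Ω} (hA : MeasurableSet A) : 0 ≤ ind P A hA := by
  rw [← AEEqFun.coeFn_le]
  filter_upwards [coeFn_ind (P := P) hA, AEEqFun.coeFn_zero (α := Ω) (μ := P) (β := ℝ)]
    with ω h1 h2
  rw [h1, h2]
  exact Set.indicator_nonneg (fun _ _ => zero_le_one) ω

theorem ind_le_one {A : Set Ω} (hA : MeasurableSet A) : ind P A hA ≤ 1 := by
  rw [← AEEqFun.coeFn_le]
  filter_upwards [coeFn_ind (P := P) hA, AEEqFun.coeFn_one (α := Ω) (μ := P) (β := ℝ)]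
    with ω h1 h2
  rw [h1, h2]
  exact Set.indicator_le_self' (fun _ _ => zero_le_one) ω

namespace IsL0ConvexFun

/-- Pasting two points along a measurable set. -/
theorem paste_le (hf : IsL0ConvexFun P f) {A : Set Ω} (hA : MeasurableSet A) (x y : E) :
    ∀ᵐ ω ∂P, (ω ∈ A → f (ind P A hA • x + (1 - ind P A hA) • y) ω ≤ f x ω) ∧
      (ω ∉ A → f (ind P A hA • x + (1 - ind P A hA) • y) ω ≤ f y ω) := by
  -- One weight vanishes at each `ω`, and `0 · (±∞) = 0` removes its term even where `f` is
  -- infinite.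
  filter_upwards [hf x y _ (ind_nonneg hA) (ind_le_one hA), coeFn_ind (P := P) hA] with ω h1 h2
  constructor <;> intro h <;> simpa [h2, h] using h1

/-- Locality of `L⁰`-convex functions. -/
theorem ae_eq_of_ind_smul_eq (hf : IsL0ConvexFun P f) {A : Set Ω} (hA : MeasurableSet A) {x y : E}
    (hxy : ind P A hA • x = ind P A hA • y) : ∀ᵐ ω ∂P, ω ∈ A → f x ω = f y ω := by
  -- Pasting `y` into `x` along `A` reproduces `x`, and symmetrically.
  have h1 := hf.paste_le hA y x
  have h2 := hf.paste_le hA x y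
  rw [← hxy, sub_smul, one_smul, add_sub_cancel] at h1
  rw [hxy, sub_smul, one_smul, add_sub_cancel] at h2
  filter_upwards [h1, h2] with ω h3 h4 h5
  exact le_antisymm (h3.1 h5) (h4.1 h5)

end IsL0ConvexFun

end Locality

/-! ### From closed sublevel sets to lower bounds on basic neighbourhoods. -/

section Semicontinuity

variable {Ω : Type*} [MeasurableSpace Ω] {P : Measure Ω} [IsProbabilityMeasure P]
variable {E : Type*} [AddCommGroup E] [Module (L0 P) E] [TopologicalSpace E] {f : E → L0bar P}

/-- Below `f x₀`, a lower semicontinuous function admits the bound `β` on a translate of a basic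
neighbourhood, at least on some non-null part of every non-null event. -/
theorem exists_basic_forall_le_on (hf : IsL0ConvexFun P f) (hlsc : IsLsc P f)
    (hadd : Continuous fun p : E × E => p.1 + p.2) (hcc : HasCountableConcat P E)
    {𝒰 : Set (Set E)} (h𝒰 : (𝓝 (0 : E)).HasBasis (fun U => U ∈ 𝒰) (fun U => U))
    (hst : ∀ U ∈ 𝒰, IsStable P U) {x₀ : E} {β : L0bar P} (hβ : ∀ᵐ ω ∂P, β ω < f x₀ ω)
    {A : Set Ω} (hA : MeasurableSet A) (hPA : P A ≠ 0) :
    ∃ B ⊆ A, MeasurableSet B ∧ P B ≠ 0 ∧ ∃ U ∈ 𝒰, ∀ u ∈ U,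
      ∀ᵐ ω ∂P, ω ∈ B → β ω ≤ f (x₀ + u) ω := by
  classical
  -- The level `⊤` off `A` makes membership in the sublevel set a condition on `A` alone.
  have hηm : Measurable (A.piecewise (fun ω => β ω) fun _ => ⊤) :=
    Measurable.piecewise hA β.measurable measurable_const
  let η : L0bar P := AEEqFun.mk _ hηm.aestronglyMeasurable
  have hη : ∀ᵐ ω ∂P, η ω = A.piecewise (fun ω => β ω) (fun _ => ⊤) ω := AEEqFun.coeFn_mk _ _
  have hx₀ : x₀ ∉ {x | f x ≤ η} := by
    intro h
    refine hPA (measure_eq_zero_iff_ae_notMem.2 ?_)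
    filter_upwards [AEEqFun.coeFn_le.2 (show f x₀ ≤ η from h), hη, hβ] with ω h1 h2 h3 h4
    rw [h2, Set.piecewise_eq_of_mem _ _ _ h4] at h1
    exact absurd h3 h1.not_gt
  have hc : Continuous fun u : E => x₀ + u := hadd.comp (continuous_const.prodMk continuous_id)
  have hnhd : (fun u : E => x₀ + u) ⁻¹' {x | f x ≤ η}ᶜ ∈ 𝓝 (0 : E) :=
    ((hlsc η).isOpen_compl.preimage hc).mem_nhds (by simpa using hx₀)
  obtain ⟨U, hU, hUsub⟩ := h𝒰.mem_iff.1 hnhd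
  -- These are the bad events. If countably many covered almost all of `A`, concatenating their
  -- points would give one `y ∈ U` with `f (x₀ + y) ≤ η`.
  let g : U → Set Ω := fun u => A ∩ {ω | f (x₀ + u) ω < β ω}
  have hg : ∀ u, MeasurableSet (g u) := fun u =>
    hA.inter (measurableSet_lt (f (x₀ + u)).measurable β.measurable)
  have : Nonempty U := (hst U hU).1.to_subtype
  obtain ⟨u, hu⟩ := exists_seq_measure_diff_iUnion_eq_zero (P := P) hg
  refine ⟨A \ ⋃ n, g (u n), Set.sdiff_subset, hA.diff (.iUnion fun n => hg _), ?_, U, hU, ?_⟩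
  · intro hnull
    obtain ⟨B, hB1, hB2⟩ := exists_countablePartition fun n => hg (u n)
    -- Index `0` is a filler: it serves the piece outside all bad events, where almost surely `η =
    -- ⊤`.
    let v : ℕ → E := fun n => Nat.casesOn n (u 0 : E) fun k => (u k : E)
    have hv : ∀ n, v n ∈ U := by
      rintro (_ | n)
      exacts [(u 0).2, (u n).2]
    obtain ⟨y, hy, -⟩ := hcc B v
    have hloc : ∀ n, ∀ᵐ ω ∂P, ω ∈ B.part (n + 1) → f (x₀ + y) ω = f (x₀ + u n) ω := fun n => by
      refine hf.ae_eq_of_ind_smul_eq (B.measurableSet_part _) ?_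
      rw [smul_add, smul_add, hy (n + 1)]
    refine hUsub ((hst U hU).2 B v y hv hy) (?_ : f (x₀ + y) ≤ η)
    rw [← AEEqFun.coeFn_le]
    filter_upwards [measure_eq_zero_iff_ae_notMem.1 hnull, hη, ae_all_iff.2 hloc] with ω h1 h2 h3
    rw [h2]
    by_cases hω : ω ∈ A
    · rw [Set.piecewise_eq_of_mem _ _ _ hω]
      obtain ⟨n, hn⟩ := hB2 ω (not_not.1 fun h => h1 ⟨hω, h⟩)
      rw [h3 n hn]
      exact (hB1 n hn).2.le
    · rw [Set.piecewise_eq_of_notMem _ _ _ hω]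
      exact le_top
  · intro w hw
    filter_upwards [measure_eq_zero_iff_ae_notMem.1 (hu ⟨w, hw⟩)] with ω h1 h2
    by_contra h
    exact h1 ⟨⟨h2.1, not_le.1 h⟩, h2.2⟩

/-- Below `f x₀`, a lower semicontinuous convex function admits the bound `β` on a translate of
a basic neighbourhood. -/
theorem exists_basic_forall_le (hf : IsL0ConvexFun P f) (hlsc : IsLsc P f)
    (hadd : Continuous fun p : E × E => p.1 + p.2) (hcc : HasCountableConcat P E)
    {𝒰 : Set (Set E)} (h𝒰 : (𝓝 (0 : E)).HasBasis (fun U => U ∈ 𝒰) (fun U => U))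
    (hst : IsStableCollection P 𝒰) {x₀ : E} {β : L0bar P} (hβ : ∀ᵐ ω ∂P, β ω < f x₀ ω) :
    ∃ U ∈ 𝒰, ∀ u ∈ U, β ≤ f (x₀ + u) := by
  let D : Set (Set Ω) := {A | MeasurableSet A ∧ ∃ U ∈ 𝒰, ∀ u ∈ U,
    ∀ᵐ ω ∂P, ω ∈ A → β ω ≤ f (x₀ + u) ω}
  obtain ⟨U₀, hU₀⟩ := hst.1
  have : Nonempty D := ⟨∅, .empty, U₀, hU₀, fun u _ => by simp⟩
  obtain ⟨B, hB⟩ := exists_seq_measure_diff_iUnion_eq_zero (P := P) (g := fun A : D => (A : Set Ω))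
    fun A => A.2.1
  have hfull : P (⋃ n, (B n : Set Ω))ᶜ = 0 := by
    by_contra hne
    obtain ⟨C, hCsub, hC, hPC, hCU⟩ := exists_basic_forall_le_on hf hlsc hadd hcc h𝒰 hst.2.1 hβ
      (MeasurableSet.iUnion fun n => (B n).2.1).compl hne
    have h := hB ⟨C, hC, hCU⟩
    rw [sdiff_eq_left.2 (Set.disjoint_left.2 hCsub)] at h
    exact hPC h
  choose U hU hUB using fun n => (B n).2.2
  obtain ⟨A, hA1, hA2⟩ := exists_countablePartition fun n => (B n).2.1
  -- `U₀` fills the null leftover piece; stability of the collection makes the concatenation basic.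
  let V : ℕ → Set E := fun n => Nat.casesOn n U₀ U
  have hV : ∀ n, V n ∈ 𝒰 := by
    rintro (_ | n)
    exacts [hU₀, hU n]
  refine ⟨concatSet P A V, hst.2.2 A V hV, ?_⟩
  rintro y ⟨v, hv, hy⟩
  have hloc : ∀ n, ∀ᵐ ω ∂P, ω ∈ A.part (n + 1) → f (x₀ + y) ω = f (x₀ + v (n + 1)) ω :=
    fun n => by
      refine hf.ae_eq_of_ind_smul_eq (A.measurableSet_part _) ?_
      rw [smul_add, smul_add, hy (n + 1)]
  have hbd : ∀ n, ∀ᵐ ω ∂P, ω ∈ (B n : Set Ω) → β ω ≤ f (x₀ + v (n + 1)) ω :=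
    fun n => hUB n _ (hv (n + 1))
  rw [← AEEqFun.coeFn_le]
  filter_upwards [measure_eq_zero_iff_ae_notMem.1 hfull, ae_all_iff.2 hloc, ae_all_iff.2 hbd]
    with ω h1 h2 h3
  obtain ⟨n, hn⟩ := hA2 ω (not_not.1 h1)
  rw [h2 n hn]
  exact h3 n (hA1 n hn)

end Semicontinuity

/-! ### Linear growth of the lower bound and finite approximation from below. -/

section LowerBound

variable {Ω : Type*} [MeasurableSpace Ω] {P : Measure Ω}
variable {E : Type*} [AddCommGroup E] [Module (L0 P) E] {f : E → L0bar P}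

theorem IsL0ConvexFun.le_toBar (hf : IsL0ConvexFun P f) {x y : E} {a b η : L0 P}
    (hx : f x ≤ toBar a) (hy : f y ≤ toBar b) (h0 : 0 ≤ η) (h1 : η ≤ 1) :
    f (η • x + (1 - η) • y) ≤ toBar (η * a + (1 - η) * b) := by
  rw [← AEEqFun.coeFn_le] at *
  filter_upwards [hf x y η (AEEqFun.coeFn_le.1 h0) (AEEqFun.coeFn_le.1 h1), hx, hy, h0, h1,
    coeFn_toBar a, coeFn_toBar b, coeFn_toBar (η * a + (1 - η) * b),
    AEEqFun.coeFn_add (η * a) ((1 - η) * b), AEEqFun.coeFn_mul η a, AEEqFun.coeFn_mul (1 - η) b,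
    AEEqFun.coeFn_sub 1 η, AEEqFun.coeFn_one (α := Ω) (μ := P) (β := ℝ),
    AEEqFun.coeFn_zero (α := Ω) (μ := P) (β := ℝ)] with ω k1 k2 k3 k4 k5 k6 k7 k8 k9 k10 k11 k12
      k13 k14
  rw [k14] at k4
  rw [k13] at k5
  rw [k6] at k2
  rw [k7] at k3
  rw [k8, k9, Pi.add_apply, k10, k11, Pi.mul_apply, Pi.mul_apply, k12, Pi.sub_apply, k13,
    Pi.one_apply, EReal.coe_add, EReal.coe_mul, EReal.coe_mul]
  refine k1.trans (add_le_add ?_ ?_)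
  · exact mul_le_mul_of_nonneg_left k2 (EReal.coe_nonneg.2 k4)
  · exact mul_le_mul_of_nonneg_left k3 (EReal.coe_nonneg.2 (sub_nonneg.2 k5))

/-- A bound near a point of finiteness propagates with linear growth. -/
theorem IsL0ConvexFun.sub_le_of_forall_le (hf : IsL0ConvexFun P f) {U : Set E}
    (hUb : IsL0Balanced P U) {x₁ : E} {r₁ : L0 P} (hx₁ : f x₁ ≤ toBar r₁)
    (hU : ∀ u ∈ U, toBar (r₁ - 1) ≤ f (x₁ + u)) {s r : L0 P} (hs : AEPos s) {u : E} (hu : u ∈ U)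
    (hr : f (x₁ + s • u) ≤ toBar r) : r₁ - (1 + s) ≤ r := by
  -- The weight `t = 1 / (1 + s)` contracts `x₁ + s u` towards `x₁` into `x₁ + U`, since `t s ≤ 1`.
  obtain ⟨t, ht, hts⟩ := (AEPos.one.add hs).exists_inv
  have hts' : t * s = 1 - t := by linear_combination hts
  have hts0 : 0 ≤ t * s := (ht.mul hs).nonneg
  have ht1 : t ≤ 1 := by rw [hts'] at hts0; exact sub_nonneg.1 hts0
  have h := hf.le_toBar hr hx₁ ht.nonneg ht1
  have h2 : t • (x₁ + s • u) + (1 - t) • x₁ = x₁ + (t * s) • u := by module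
  have h3 : (t * s) • u ∈ U := hUb u hu _ (by
    rw [abs_of_nonneg hts0, hts']
    exact sub_le_self 1 ht.nonneg)
  rw [h2] at h
  have h4 := toBar_le_toBar.1 ((hU _ h3).trans h)
  refine AEPos.le_of_mul_le_mul_left ht ?_
  rw [← sub_nonneg] at h4 ⊢
  convert h4 using 1
  linear_combination hts

/-- A bound near `x₀` and a bound near a point of finiteness combine to a bound with linear growth
at `x₀`. -/
theorem IsL0ConvexFun.exists_neg_mul_le (hf : IsL0ConvexFun P f) {U : Set E}
    (hUc : IsL0Convex P U) (hUa : IsL0Absorbing P U) (hUb : IsL0Balanced P U)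
    {x₀ x₁ : E} {β r₁ : L0 P} (hx₁ : f x₁ ≤ toBar r₁)
    (hU₀ : ∀ u ∈ U, toBar β ≤ f (x₀ + u)) (hU₁ : ∀ u ∈ U, toBar (r₁ - 1) ≤ f (x₁ + u)) :
    ∃ K : L0 P, ∀ r (η : L0 P), ∀ u ∈ U, AEPos η → f (x₀ + η • u) ≤ toBar (r + β) →
      -(K * η) ≤ r := by
  obtain ⟨θ, hθ, w, hw, hxw⟩ := hUa (x₀ - x₁)
  -- Where `η > 1`, the far bound `r ≥ r₁ - β - 1 - θ - η` is at least `-K η`. Where `η ≤ 1`, the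
  -- near bound already gives `r ≥ 0`.
  let K : L0 P := |r₁ - β| + θ + 2
  refine ⟨K, fun r η u hu hη hr => ?_⟩
  have hfar : r₁ - (1 + (θ + η)) ≤ r + β := by
    obtain ⟨z, hz, huz⟩ := hUc.exists_smul_add_smul hθ hη hw hu
    refine hf.sub_le_of_forall_le hUb hx₁ hU₁ (hθ.add hη) hz ?_
    rw [← huz, ← hxw]
    convert hr using 2
    abel
  let A : Set Ω := {ω | η ω ≤ 1}
  have hA : MeasurableSet A := measurableSet_le η.measurable measurable_const
  -- Cutting `η` off outside `A` puts the point into `U`; locality transfers the near bound back on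
  -- `A`.
  have hmem : (ind P A hA * η) • u ∈ U := by
    refine hUb u hu _ ?_
    rw [abs_of_nonneg (L0.mul_nonneg (ind_nonneg hA) hη.nonneg), ← AEEqFun.coeFn_le]
    filter_upwards [AEEqFun.coeFn_mul (ind P A hA) η, coeFn_ind (P := P) hA,
      AEEqFun.coeFn_one (α := Ω) (μ := P) (β := ℝ)] with ω h1 h2 h3
    rw [h1, h3, Pi.mul_apply, h2]
    by_cases hω : ω ∈ A
    · rw [Set.indicator_of_mem hω, one_mul]
      exact hω
    · simp [hω]
  have hidem : ind P A hA * ind P A hA = ind P A hA := by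
    apply AEEqFun.ext
    filter_upwards [AEEqFun.coeFn_mul (ind P A hA) (ind P A hA), coeFn_ind (P := P) hA]
      with ω h1 h2
    rw [h1, Pi.mul_apply, h2]
    by_cases hω : ω ∈ A <;> simp [hω]
  have hloc := hf.ae_eq_of_ind_smul_eq hA (x := x₀ + (ind P A hA * η) • u) (y := x₀ + η • u) (by
    rw [smul_add, smul_add, smul_smul, smul_smul, ← mul_assoc, hidem])
  have hnear := hU₀ _ hmem
  rw [← AEEqFun.coeFn_le] at hnear hfar hr ⊢
  filter_upwards [hloc, hnear, hfar, hr, coeFn_toBar β, coeFn_toBar (r + β),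
    AEEqFun.coeFn_add r β, AEEqFun.coeFn_sub r₁ (1 + (θ + η)), AEEqFun.coeFn_add 1 (θ + η),
    AEEqFun.coeFn_add θ η, AEEqFun.coeFn_one (α := Ω) (μ := P) (β := ℝ),
    AEEqFun.coeFn_neg (K * η), AEEqFun.coeFn_mul K η, AEEqFun.coeFn_add (|r₁ - β| + θ) 2,
    AEEqFun.coeFn_add |r₁ - β| θ, AEEqFun.coeFn_abs (r₁ - β), AEEqFun.coeFn_sub r₁ β,
    AEEqFun.coeFn_add (1 : L0 P) 1, hη, hθ]
    with ω h1 h2 h3 h4 h5 h6 h7 h8 h9 h10 h11 h12 h13 h14 h15 h16 h17 h18 h19 h20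
  have hK : K ω = |r₁ ω - β ω| + θ ω + 2 := by
    rw [show K = |r₁ - β| + θ + 2 from rfl, h14, Pi.add_apply, h15, Pi.add_apply, h16, h17,
      Pi.sub_apply, ← one_add_one_eq_two, h18, Pi.add_apply, h11, Pi.one_apply,
      one_add_one_eq_two]
  rw [h12, Pi.neg_apply, h13, Pi.mul_apply, hK]
  rw [h8, Pi.sub_apply, h9, Pi.add_apply, h10, Pi.add_apply, h11, Pi.one_apply, h7,
    Pi.add_apply] at h3
  have h21 := neg_abs_le (r₁ ω - β ω)
  have h22 := abs_nonneg (r₁ ω - β ω)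
  rcases le_or_gt (η ω) 1 with hω | hω
  · rw [h1 hω, h5] at h2
    have h23 := h2.trans h4
    rw [h6, h7, Pi.add_apply, EReal.coe_le_coe_iff] at h23
    have h24 : 0 ≤ (|r₁ ω - β ω| + θ ω + 2) * η ω := by positivity
    linarith
  · nlinarith

/-- An extended random variable above every finite random variable strictly below `g` is
above `g`. -/
theorem le_of_forall_toBar_le {g h : L0bar P} (hg : ∀ᵐ ω ∂P, ⊥ < g ω)
    (H : ∀ β : L0 P, (∀ᵐ ω ∂P, ((β ω : ℝ) : EReal) < g ω) → toBar β ≤ h) : g ≤ h := by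
  -- Truncation at `n` makes `g` finite, and subtracting `1 / (n + 1)` makes the inequality strict;
  -- both effects vanish in the limit.
  have hm : ∀ n : ℕ, Measurable fun ω => (min (g ω) ((n : ℝ) : EReal)).toReal - 1 / ((n : ℝ) + 1) :=
    fun n => ((g.measurable.min measurable_const).ereal_toReal).sub_const _
  let β : ℕ → L0 P := fun n => AEEqFun.mk _ (hm n).aestronglyMeasurable
  have hβ : ∀ n, ∀ᵐ ω ∂P, β n ω = (min (g ω) ((n : ℝ) : EReal)).toReal - 1 / ((n : ℝ) + 1) :=
    fun n => AEEqFun.coeFn_mk _ _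
  have hmin : ∀ n : ℕ, ∀ a : EReal, ⊥ < a →
      (((min a ((n : ℝ) : EReal)).toReal : ℝ) : EReal) = min a ((n : ℝ) : EReal) := fun n a ha =>
    EReal.coe_toReal ((min_le_right _ _).trans_lt (EReal.coe_lt_top _)).ne
      (lt_min ha (EReal.bot_lt_coe _)).ne'
  have hlt : ∀ n, ∀ᵐ ω ∂P, ((β n ω : ℝ) : EReal) < g ω := fun n => by
    filter_upwards [hβ n, hg] with ω h1 h2
    refine lt_of_lt_of_le ?_ (min_le_left (g ω) ((n : ℝ) : EReal))
    rw [← hmin n _ h2, h1, EReal.coe_lt_coe_iff]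
    exact sub_lt_self _ (by positivity)
  rw [← AEEqFun.coeFn_le]
  filter_upwards [ae_all_iff.2 fun n => AEEqFun.coeFn_le.2 (H (β n) (hlt n)), ae_all_iff.2 hβ,
    ae_all_iff.2 fun n => coeFn_toBar (β n), hg] with ω h1 h2 h3 h4
  refine EReal.ge_of_forall_gt_iff_ge.1 fun c hc => ?_
  obtain ⟨d, hcd, hdg⟩ := EReal.lt_iff_exists_real_btwn.1 hc
  rw [EReal.coe_lt_coe_iff] at hcd
  obtain ⟨n, hn1, hn2⟩ := ((tendsto_one_div_add_atTop_nhds_zero_nat.eventually_lt_const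
    (sub_pos.2 hcd)).and (tendsto_natCast_atTop_atTop.eventually_ge_atTop d)).exists
  have hd : d ≤ (min (g ω) ((n : ℝ) : EReal)).toReal := by
    rw [← EReal.coe_le_coe_iff, hmin n _ h4]
    exact le_min hdg.le (EReal.coe_le_coe_iff.2 hn2)
  refine le_trans ?_ (h1 n)
  rw [h3 n, h2 n, EReal.coe_le_coe_iff]
  linarith

end LowerBound

/-! ### Continuity, conjugates and affine minorants. -/

section Duality

variable {Ω : Type*} [MeasurableSpace Ω] {P : Measure Ω}
variable {E : Type*} [AddCommGroup E] [Module (L0 P) E] [TopologicalSpace E]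

/-- A linear map bounded above on a balanced neighbourhood of zero is continuous. -/
theorem continuous_of_le_on_nhds (hadd : Continuous fun p : E × E => p.1 + p.2)
    (hsmul : Continuous fun p : L0 P × E => p.1 • p.2) {U : Set E} (hU : U ∈ 𝓝 (0 : E))
    (hUb : IsL0Balanced P U) (μ : E →ₗ[L0 P] L0 P) {M : L0 P} (hM : ∀ u ∈ U, μ u ≤ M) :
    Continuous μ := by
  have habs : ∀ u ∈ U, |μ u| ≤ M := fun u hu => abs_le'.2 ⟨hM u hu, by
    rw [← map_neg]
    exact hM _ (hUb.neg_mem hu)⟩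
  have hM1 : AEPos (1 + |M|) := AEPos.one.add_nonneg (abs_nonneg M)
  obtain ⟨s, hs, hMs⟩ := hM1.exists_inv
  rw [continuous_def]
  intro V hV
  rw [isOpen_iff_mem_nhds]
  intro x hx
  obtain ⟨ε, hε, hεV⟩ := hV (μ x) hx
  obtain ⟨δ, hδ, hεδ⟩ := hε.exists_inv
  -- With `δ = 1 / ε`, the estimate `|μ| ≤ 1 + |M|` on `U` becomes `|μ y - μ x| ≤ ε`. Unlike `M`,
  -- the scalar `1 + |M|` is always invertible.
  have hc : Continuous fun y : E => ((1 + |M|) * δ) • (y + -x) :=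
    hsmul.comp (continuous_const.prodMk (hadd.comp (continuous_id.prodMk continuous_const)))
  have hn : (fun y : E => ((1 + |M|) * δ) • (y + -x)) ⁻¹' U ∈ 𝓝 x :=
    hc.continuousAt.preimage_mem_nhds (by simpa using hU)
  filter_upwards [hn] with y hy
  refine hεV _ ?_
  have h1 := (habs _ hy).trans (le_abs_self M)
  rw [map_smul, smul_eq_mul, map_add, map_neg, ← sub_eq_add_neg] at h1
  have hpos := hM1.mul hδ
  have h2 : |(1 + |M|) * δ * (μ y - μ x)| = (1 + |M|) * δ * |μ y - μ x| := by
    apply AEEqFun.ext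
    filter_upwards [AEEqFun.coeFn_abs ((1 + |M|) * δ * (μ y - μ x)), hpos,
      AEEqFun.coeFn_mul ((1 + |M|) * δ) (μ y - μ x), AEEqFun.coeFn_abs (μ y - μ x),
      AEEqFun.coeFn_mul ((1 + |M|) * δ) |μ y - μ x|] with ω k1 k2 k3 k4 k5
    rw [k1, k3, k5, Pi.mul_apply, Pi.mul_apply, k4, abs_mul, abs_of_pos k2]
  rw [h2] at h1
  refine AEPos.le_of_mul_le_mul_left hpos (h1.trans ?_)
  rw [show (1 + |M|) * δ * ε = 1 + |M| by linear_combination (1 + |M|) * hεδ]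
  exact le_add_of_nonneg_left zero_le_one

theorem coeFn_subExt (r : L0 P) (g : L0bar P) :
    ∀ᵐ ω ∂P, subExt r g ω = ((r ω : ℝ) : EReal) - g ω :=
  AEEqFun.coeFn_mk _ _

variable [IsProbabilityMeasure P] {f : E → L0bar P}

/-- Young–Fenchel, rearranged pointwise. Where `f x` is finite, the conjugate cannot be `-∞`, so no
infinite value spoils the rearrangement. -/
theorem biconj_le (hf : ∀ x, ∀ᵐ ω ∂P, ⊥ < f x ω) : biconj P f ≤ f := by
  intro x
  refine (isLUB_esssup _).2 ?_
  rintro _ ⟨μ, rfl⟩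
  have h : subExt (μ x) (f x) ≤ conj P f μ := (isLUB_esssup _).1 ⟨x, rfl⟩
  rw [← AEEqFun.coeFn_le] at h ⊢
  filter_upwards [h, coeFn_subExt (μ x) (f x), coeFn_subExt (μ x) (conj P f μ), hf x]
    with ω h1 h2 h3 h4
  rw [h2] at h1
  rw [h3]
  generalize conj P f μ ω = c at *
  generalize f x ω = a at *
  generalize (μ x) ω = m at *
  induction a with
  | bot => exact absurd h4 (lt_irrefl _)
  | top => exact le_top
  | coe a =>
    induction c with
    | bot =>
      rw [← EReal.coe_sub] at h1
      exact absurd (le_bot_iff.1 h1) (EReal.coe_ne_bot _)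
    | top =>
      rw [EReal.sub_top]
      exact bot_le
    | coe c =>
      rw [← EReal.coe_sub, EReal.coe_le_coe_iff] at h1 ⊢
      linarith

/-- A linear minorant of slope `μ` at level `β` over `x₀` bounds the conjugate; it is enough to
test it against finite values. -/
theorem conj_le_of_forall_le (hf : IsL0ConvexFun P f) (hbot : ∀ x, ∀ᵐ ω ∂P, ⊥ < f x ω)
    {x₁ : E} {r₁ : L0 P} (hx₁ : f x₁ ≤ toBar r₁) {μ : Dual P E} {m : L0 P}
    (hμ : ∀ x r, f x ≤ toBar r → μ x - r ≤ m) : conj P f μ ≤ toBar m := by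
  refine (isLUB_esssup _).2 ?_
  rintro _ ⟨x, rfl⟩
  let A : Set Ω := {ω | f x ω < ⊤}
  have hA : MeasurableSet A := measurableSet_lt (f x).measurable measurable_const
  -- Replacing `x` by `x₁` where `f x = ∞` gives a point with finite value, to which `hμ` applies.
  -- Off `A` the difference `μ x - f x` is `-∞`.
  let y : E := ind P A hA • x + (1 - ind P A hA) • x₁
  let r : L0 P := AEEqFun.compMeasurable EReal.toReal measurable_ereal_toReal (f y)
  have hr : ∀ᵐ ω ∂P, r ω = (f y ω).toReal :=
    AEEqFun.coeFn_compMeasurable EReal.toReal measurable_ereal_toReal _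
  have hfr : ∀ᵐ ω ∂P, f y ω = ((r ω : ℝ) : EReal) := by
    filter_upwards [hr, hbot y, hf.paste_le hA x x₁, AEEqFun.coeFn_le.2 hx₁, coeFn_toBar r₁]
      with ω h1 h2 h3 h4 h5
    rw [h1, EReal.coe_toReal _ h2.ne']
    by_cases hω : ω ∈ A
    · exact ((h3.1 hω).trans_lt hω).ne
    · rw [h5] at h4
      exact (((h3.2 hω).trans h4).trans_lt (EReal.coe_lt_top _)).ne
  have hm := hμ y r (by
    rw [← AEEqFun.coeFn_le]
    filter_upwards [hfr, coeFn_toBar r] with ω h1 h2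
    rw [h1, h2])
  have hμy : μ y = ind P A hA * μ x + (1 - ind P A hA) * μ x₁ := by
    rw [map_add, map_smul, map_smul, smul_eq_mul, smul_eq_mul]
  rw [hμy] at hm
  rw [← AEEqFun.coeFn_le] at hm ⊢
  filter_upwards [hm, coeFn_subExt (μ x) (f x), coeFn_toBar m, hfr, hf.paste_le hA x x₁,
    AEEqFun.coeFn_sub (ind P A hA * μ x + (1 - ind P A hA) * μ x₁) r,
    AEEqFun.coeFn_add (ind P A hA * μ x) ((1 - ind P A hA) * μ x₁),
    AEEqFun.coeFn_mul (ind P A hA) (μ x), AEEqFun.coeFn_mul (1 - ind P A hA) (μ x₁),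
    AEEqFun.coeFn_sub 1 (ind P A hA), AEEqFun.coeFn_one (α := Ω) (μ := P) (β := ℝ),
    coeFn_ind (P := P) hA] with ω h1 h2 h3 h4 h5 h6 h7 h8 h9 h10 h11 h12
  rw [h2, h3]
  by_cases hω : ω ∈ A
  · rw [h6, Pi.sub_apply, h7, Pi.add_apply, h8, h9, Pi.mul_apply, Pi.mul_apply, h10, Pi.sub_apply,
      h11, h12, Set.indicator_of_mem hω, Pi.one_apply, one_mul, sub_self, zero_mul, add_zero] at h1
    have h13 := h5.1 hω
    change f y ω ≤ f x ω at h13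
    rw [h4] at h13
    calc ((μ x ω : ℝ) : EReal) - f x ω ≤ ((μ x ω : ℝ) : EReal) - ((r ω : ℝ) : EReal) :=
          EReal.sub_le_sub le_rfl h13
      _ ≤ ((m ω : ℝ) : EReal) := by
          rw [← EReal.coe_sub, EReal.coe_le_coe_iff]
          exact h1
  · have h13 : f x ω = ⊤ := not_lt_top_iff.1 hω
    rw [h13, EReal.sub_top]
    exact bot_le

/-- The sandwich theorem, applied to `f (x₀ + ·) - β`, gives a slope `ν` with `ν x - ν x₀ + β ≤ f
x`. Hence `f* ν ≤ ν x₀ - β`, which makes `ν` a witness for `β` in the biconjugate. -/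
theorem toBar_le_biconj (hE : IsStableLocallyL0Convex P E) (hproper : IsProper P f)
    (hlsc : IsLsc P f) (hconv : IsL0ConvexFun P f) {x₀ : E} {β : L0 P}
    (hβ : ∀ᵐ ω ∂P, ((β ω : ℝ) : EReal) < f x₀ ω) : toBar β ≤ biconj P f x₀ := by
  obtain ⟨hbot, x₁, r₁, hr₁⟩ := hproper
  obtain ⟨𝒰, h𝒰, hst, hprop⟩ := hE.exists_base
  have hx₁ : f x₁ ≤ toBar r₁ := by
    rw [← AEEqFun.coeFn_le]
    filter_upwards [hr₁, coeFn_toBar r₁] with ω h1 h2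
    rw [h1, h2]
  obtain ⟨U₀, hU₀, hβU₀⟩ := exists_basic_forall_le (β := toBar β) hconv hlsc hE.continuous_add
    hE.concat h𝒰 hst (x₀ := x₀) (by
      filter_upwards [hβ, coeFn_toBar β] with ω h1 h2
      rwa [h2])
  obtain ⟨U₁, hU₁, hβU₁⟩ := exists_basic_forall_le (β := toBar (r₁ - 1)) hconv hlsc
    hE.continuous_add hE.concat h𝒰 hst (x₀ := x₁) (by
      filter_upwards [hr₁, coeFn_toBar (r₁ - 1), AEEqFun.coeFn_sub r₁ 1,
        AEEqFun.coeFn_one (α := Ω) (μ := P) (β := ℝ)] with ω h1 h2 h3 h4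
      rw [h1, h2, h3, Pi.sub_apply, h4, EReal.coe_lt_coe_iff]
      exact sub_one_lt _)
  obtain ⟨U, hU, hUsub⟩ := h𝒰.mem_iff.1
    (Filter.inter_mem (h𝒰.mem_of_mem hU₀) (h𝒰.mem_of_mem hU₁))
  obtain ⟨hUc, hUa, hUb⟩ := hprop U hU
  obtain ⟨K, hK⟩ := hconv.exists_neg_mul_le hUc hUa hUb hx₁
    (fun u hu => hβU₀ u (hUsub hu).1) (fun u hu => hβU₁ u (hUsub hu).2)
  obtain ⟨μ, hμ, M, hM⟩ := exists_linearMap_le_of_convex hUc hUa hUb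
    -- Moving `β` to the right-hand side avoids subtraction in the extended `L⁰`.
    (C := fun z r => f (x₀ + z) ≤ toBar (r + β))
    (fun x r y s η hx hy h0 h1 => by
      have h := hconv.le_toBar hx hy h0 h1
      convert h using 2
      · module
      · ring)
    hK ⟨x₁ - x₀, r₁ - β, by simpa using hx₁⟩
  let ν : Dual P E := ⟨μ, continuous_of_le_on_nhds hE.continuous_add hE.continuous_smul
    (h𝒰.mem_of_mem hU) hUb μ hM⟩
  have hconj : conj P f ν ≤ toBar (ν x₀ - β) :=
    conj_le_of_forall_le hconv hbot hx₁ fun x r hx => by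
      have h := hμ (x - x₀) (r - β) (by simpa using hx)
      rw [map_sub] at h
      change μ x - r ≤ μ x₀ - β
      rw [← sub_nonneg] at h ⊢
      convert h using 1
      ring
  refine le_trans ?_ ((isLUB_esssup _).1 ⟨ν, rfl⟩)
  rw [← AEEqFun.coeFn_le] at hconj ⊢
  filter_upwards [hconj, coeFn_toBar β, coeFn_toBar (ν x₀ - β), AEEqFun.coeFn_sub (ν x₀) β,
    coeFn_subExt (ν x₀) (conj P f ν)] with ω h1 h2 h3 h4 h5
  rw [h2, h5]
  rw [h3, h4, Pi.sub_apply] at h1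
  calc ((β ω : ℝ) : EReal) = ((ν x₀ ω : ℝ) : EReal) - ((ν x₀ ω - β ω : ℝ) : EReal) := by
        rw [← EReal.coe_sub, sub_sub_cancel]
    _ ≤ _ := EReal.sub_le_sub le_rfl h1

end Duality

end

end L0Mod

theorem mainTheorem5 {Ω : Type*} [MeasurableSpace Ω] (P : Measure Ω) [IsProbabilityMeasure P]
    {E : Type*} [AddCommGroup E] [Module (L0Mod.L0 P) E] [TopologicalSpace E]
    (hE : L0Mod.IsStableLocallyL0Convex P E) (f : E → L0Mod.L0bar P)
    (hproper : L0Mod.IsProper P f) (hlsc : L0Mod.IsLsc P f) (hconv : L0Mod.IsL0ConvexFun P f) :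
    L0Mod.biconj P f = f :=
  le_antisymm (L0Mod.biconj_le hproper.1) fun x =>
    L0Mod.le_of_forall_toBar_le (hproper.1 x) fun _ hβ =>
      L0Mod.toBar_le_biconj hE hproper hlsc hconv hβ
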